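/- Let $n\ge 4$ and let $K=\operatorname{conv}(SO(n))\subset\mathbb{R}^{n\times n}$ be the tautological orbitope of $SO(n)$, on which $SO(n)\times SO(n)$ acts by $(U,V)\cdot X=UXV^{T}$. A face of $K$ is a closed convex subset $F\subseteq K$ that contains both endpoints of every open segment in $K$ that it meets; a facet is an inclusion-maximal face different from $K$. Then the facets of $K$ form exactly two distinct orbits under $SO(n)\times SO(n)$. Every facet in one orbit is affinely isomorphic to the tautological orbitope $\operatorname{conv}(SO(n-1))\subset\mathbb{R}^{(n-1)\times(n-1)}$. Every facet in the other orbit is affinely isomorphic to the free spectrahedron $\{X\in\mathbb{R}^{n\times n}: X=X^{T},\ X\succeq 0,\ \operatorname{trace}X=1\}$ and has dimension $\binom{n+1}{2}-1$. -/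

import Mathlib

open Matrix

section Convexity

variable {E F : Type*} [AddCommGroup E] [Module ℝ E] [AddCommGroup F] [Module ℝ F]

/-- A face of a convex set `K`: a closed convex subset `S` of `K` that contains both endpoints of
every open segment in `K` that it meets. Both `∅` and `K` (if closed) are faces. -/
def IsConvexFace [TopologicalSpace E] (K S : Set E) : Prop :=
  IsClosed S ∧ Convex ℝ S ∧ IsExtreme ℝ K S

/-- A facet of `K`: an inclusion-maximal proper face. -/
def IsConvexFacet [TopologicalSpace E] (K S : Set E) : Prop :=
  Maximal (fun T : Set E => IsConvexFace K T ∧ T ≠ K) S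

/-- `S` and `T` are affinely isomorphic: some affine map is injective on the affine hull of `S` and
carries `S` onto `T` (hence it carries the affine hull of `S` isomorphically onto that of `T`). -/
def AffinelyIsomorphic (S : Set E) (T : Set F) : Prop :=
  ∃ f : E →ᵃ[ℝ] F, Set.InjOn f (affineSpan ℝ S : Set E) ∧ f '' S = T

/-- The dimension of a nonempty convex set is the dimension of its affine hull. -/
noncomputable def convexDim (S : Set E) : ℕ :=
  Module.finrank ℝ (affineSpan ℝ S).direction

end Convexity

/-- The tautological orbitope of `SO(n)`: the convex hull of the rotation matrices in the space of
real `n × n` matrices. -/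
def tautologicalOrbitopeSO (n : ℕ) : Set (Matrix (Fin n) (Fin n) ℝ) :=
  convexHull ℝ {g : Matrix (Fin n) (Fin n) ℝ | g ∈ specialOrthogonalGroup (Fin n) ℝ}

/-- The free spectrahedron: positive semidefinite symmetric real `n × n` matrices of trace one. -/
def freeSpectrahedron (n : ℕ) : Set (Matrix (Fin n) (Fin n) ℝ) :=
  {X : Matrix (Fin n) (Fin n) ℝ | X.PosSemidef ∧ X.trace = 1}

/-- The orbit of a set of matrices under the action of `SO(n) × SO(n)` by left and right
multiplication, `(U, V) · X = U X Vᵀ`. -/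
def rotationOrbit (n : ℕ) (S : Set (Matrix (Fin n) (Fin n) ℝ)) :
    Set (Set (Matrix (Fin n) (Fin n) ℝ)) :=
  {T | ∃ U ∈ specialOrthogonalGroup (Fin n) ℝ, ∃ V ∈ specialOrthogonalGroup (Fin n) ℝ,
    T = (fun X : Matrix (Fin n) (Fin n) ℝ => U * X * Vᵀ) '' S}

/-- The set of all `SO(n) × SO(n)`-orbits of facets of the tautological orbitope of `SO(n)`. -/
def facetOrbitsSO (n : ℕ) : Set (Set (Set (Matrix (Fin n) (Fin n) ℝ))) :=
  {O | ∃ S, IsConvexFacet (tautologicalOrbitopeSO n) S ∧ O = rotationOrbit n S}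

/-! Facets are found by maximising linear functionals `⟨C, ·⟩` over rotations. The orbitope has
nonempty interior for `n ≥ 3`, so every nonempty proper face lies in the maximum set of some `C ≠
0`. Write `C = A diag(c) Bᵀ` with `A`, `B` orthogonal and `c ≥ 0`, and let `x i` be the diagonal
entries of `Aᵀ X B`, so that `⟨C, X⟩ = ∑ c i * x i`. Two inequalities hold on the orbitope: `x i ≤
1`, and `⟨R, X⟩ ≤ n - 2` for `R` orthogonal of determinant `-1`.

If `A Bᵀ` is a rotation, it attains `∑ c i`, so `x i = 1` on the face wherever `c i > 0`. Otherwise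
flipping the sign at the smallest `c k` gives a rotation with value `∑ c i - 2 * c k`; when `c k >
0`, the two inequalities force `⟨A Bᵀ, X⟩ = n - 2` on the face, and when `c k = 0` the first case
recurs. Hence every proper face lies in a slice whose normal is either a rank one matrix `v uᵀ` or
an improper orthogonal matrix (`exists_slice_of_exposed`).

For `n ≥ 4` no slice contains another, as is seen by testing on a point of the slice proportional to
its own normal. So the slices are exactly the facets, and each family of normals is one orbit. A
slice is the hull of the rotations in it: up to rotation these are the `1 ⊕ Y` with `Y ∈ SO(n - 1)`
in the first family, and the `R (1 - 2 w wᵀ)` in the second, where `w wᵀ` ranges over the extreme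
points of the free spectrahedron. -/

/-! ### The Frobenius inner product -/

section Pairing

variable {ι : Type*} [Fintype ι] [DecidableEq ι]

/-- The Frobenius pairing `⟨C, X⟩ = trace (Cᵀ X)`, as a linear functional of `X`. -/
def frobeniusPairing (C : Matrix ι ι ℝ) : Matrix ι ι ℝ →ₗ[ℝ] ℝ :=
  traceLinearMap ι ℝ ℝ ∘ₗ LinearMap.mulLeft ℝ Cᵀ

lemma frobeniusPairing_apply (C X : Matrix ι ι ℝ) : frobeniusPairing C X = (Cᵀ * X).trace := rfl

lemma frobeniusPairing_comm (C X : Matrix ι ι ℝ) :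
    frobeniusPairing C X = frobeniusPairing X C := by
  rw [frobeniusPairing_apply, frobeniusPairing_apply, ← trace_transpose, transpose_mul,
    transpose_transpose]

lemma frobeniusPairing_self_nonneg (C : Matrix ι ι ℝ) : 0 ≤ frobeniusPairing C C := by
  rw [frobeniusPairing_apply, ← conjTranspose_eq_transpose_of_trivial]
  exact (posSemidef_conjTranspose_mul_self C).trace_nonneg

lemma frobeniusPairing_self_eq_zero {C : Matrix ι ι ℝ} (h : frobeniusPairing C C = 0) : C = 0 := by
  rw [frobeniusPairing_apply, ← conjTranspose_eq_transpose_of_trivial] at h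
  exact trace_conjTranspose_mul_self_eq_zero_iff.1 h

lemma frobeniusPairing_sub_sub (C D : Matrix ι ι ℝ) :
    frobeniusPairing (C - D) (C - D)
      = frobeniusPairing C C - 2 * frobeniusPairing C D + frobeniusPairing D D := by
  have h : frobeniusPairing (C - D) = frobeniusPairing C - frobeniusPairing D := by
    ext X
    simp [frobeniusPairing_apply, sub_mul]
  rw [h, LinearMap.sub_apply, map_sub, map_sub, frobeniusPairing_comm D C]
  ring

/-- The equality case of the Cauchy–Schwarz inequality for matrices of equal norm. -/
lemma eq_of_frobeniusPairing_eq {C D : Matrix ι ι ℝ} {a : ℝ} (hC : frobeniusPairing C C = a)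
    (hD : frobeniusPairing D D = a) (h : frobeniusPairing C D = a) : C = D := by
  refine sub_eq_zero.1 (frobeniusPairing_self_eq_zero ?_)
  rw [frobeniusPairing_sub_sub, hC, hD, h]
  ring

lemma frobeniusPairing_le {C D : Matrix ι ι ℝ} {a : ℝ} (hC : frobeniusPairing C C = a)
    (hD : frobeniusPairing D D = a) : frobeniusPairing C D ≤ a := by
  have := frobeniusPairing_self_nonneg (C - D)
  rw [frobeniusPairing_sub_sub, hC, hD] at this
  linarith

lemma frobeniusPairing_mul_mul (A B C X : Matrix ι ι ℝ) :
    frobeniusPairing (A * C * Bᵀ) X = frobeniusPairing C (Aᵀ * X * B) := by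
  rw [frobeniusPairing_apply, frobeniusPairing_apply, transpose_mul, transpose_mul,
    transpose_transpose, Matrix.mul_assoc, trace_mul_comm]
  simp only [Matrix.mul_assoc]

lemma frobeniusPairing_single (i j : ι) (X : Matrix ι ι ℝ) :
    frobeniusPairing (single i j 1) X = X i j := by
  simp [frobeniusPairing_apply, trace_single_mul]

lemma frobeniusPairing_diagonal (c : ι → ℝ) (X : Matrix ι ι ℝ) :
    frobeniusPairing (diagonal c) X = ∑ i, c i * X i i := by
  simp [frobeniusPairing_apply, Matrix.trace]

lemma exists_eq_frobeniusPairing (f : Matrix ι ι ℝ →ₗ[ℝ] ℝ) : ∃ C, f = frobeniusPairing C := by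
  refine ⟨of fun i j => f (single i j 1), ?_⟩
  refine LinearMap.ext fun X => ?_
  rw [matrix_eq_sum_single X]
  simp only [map_sum]
  refine Finset.sum_congr rfl fun i _ => Finset.sum_congr rfl fun j _ => ?_
  have h : single i j (X i j) = X i j • single i j (1 : ℝ) := by rw [smul_single, smul_eq_mul, mul_one]
  rw [h, map_smul, map_smul, frobeniusPairing_comm, frobeniusPairing_single, of_apply]

end Pairing

/-! ### Reflections and orthogonal matrices -/

section Householder

variable {ι : Type*} [DecidableEq ι]

/-- The reflection `1 - 2 w wᵀ` along a unit vector `w`. -/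
def householder (w : ι → ℝ) : Matrix ι ι ℝ := 1 - (2 : ℝ) • vecMulVec w w

lemma householder_transpose (w : ι → ℝ) : (householder w)ᵀ = householder w := by
  simp [householder, transpose_vecMulVec]

end Householder

section Orthogonal

variable {ι : Type*} [Fintype ι] [DecidableEq ι] {A B g R : Matrix ι ι ℝ}

lemma mul_transpose_of_orthogonal (hA : A ∈ orthogonalGroup ι ℝ) : A * Aᵀ = 1 :=
  (mem_orthogonalGroup_iff ι ℝ).1 hA

lemma transpose_mul_of_orthogonal (hA : A ∈ orthogonalGroup ι ℝ) : Aᵀ * A = 1 :=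
  (mem_orthogonalGroup_iff' ι ℝ).1 hA

lemma transpose_mem_orthogonalGroup (hA : A ∈ orthogonalGroup ι ℝ) : Aᵀ ∈ orthogonalGroup ι ℝ := by
  rw [mem_orthogonalGroup_iff, transpose_transpose, transpose_mul_of_orthogonal hA]

lemma transpose_mem_specialOrthogonalGroup (hA : A ∈ specialOrthogonalGroup ι ℝ) :
    Aᵀ ∈ specialOrthogonalGroup ι ℝ := by
  rw [mem_specialOrthogonalGroup_iff] at hA ⊢
  exact ⟨transpose_mem_orthogonalGroup hA.1, by rw [det_transpose, hA.2]⟩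

lemma det_eq_one_or_neg_one_of_orthogonal (hA : A ∈ orthogonalGroup ι ℝ) :
    A.det = 1 ∨ A.det = -1 := by
  have h := congrArg det (mul_transpose_of_orthogonal hA)
  rw [det_mul, det_transpose, det_one] at h
  exact mul_self_eq_one_iff.1 h

lemma entry_le_one_of_orthogonal (hA : A ∈ orthogonalGroup ι ℝ) (i j : ι) : A i j ≤ 1 :=
  (le_abs_self _).trans (entry_norm_bound_of_unitary (𝕜 := ℝ) hA i j)

lemma frobeniusPairing_self_of_orthogonal (hA : A ∈ orthogonalGroup ι ℝ) :
    frobeniusPairing A A = Fintype.card ι := by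
  rw [frobeniusPairing_apply, transpose_mul_of_orthogonal hA, trace_one]

lemma frobeniusPairing_mul_mul_of_orthogonal (hA : A ∈ orthogonalGroup ι ℝ)
    (hB : B ∈ orthogonalGroup ι ℝ) (C X : Matrix ι ι ℝ) :
    frobeniusPairing (A * C * Bᵀ) (A * X * Bᵀ) = frobeniusPairing C X := by
  rw [frobeniusPairing_mul_mul]
  congr 1
  calc Aᵀ * (A * X * Bᵀ) * B = (Aᵀ * A) * X * (Bᵀ * B) := by simp only [Matrix.mul_assoc]
    _ = X := by
      rw [transpose_mul_of_orthogonal hA, transpose_mul_of_orthogonal hB, Matrix.one_mul,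
        Matrix.mul_one]

lemma frobeniusPairing_mul_single_mul_le (hA : A ∈ orthogonalGroup ι ℝ)
    (hB : B ∈ orthogonalGroup ι ℝ) (hg : g ∈ orthogonalGroup ι ℝ) (i : ι) :
    frobeniusPairing (A * single i i 1 * Bᵀ) g ≤ 1 := by
  rw [frobeniusPairing_mul_mul, frobeniusPairing_single]
  exact entry_le_one_of_orthogonal (mul_mem (mul_mem (transpose_mem_orthogonalGroup hA) hg) hB) i i

lemma householder_mul_self {w : ι → ℝ} (hw : w ⬝ᵥ w = 1) :
    householder w * householder w = 1 := by
  have h : vecMulVec w w * vecMulVec w w = vecMulVec w w := by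
    rw [vecMulVec_mul_vecMulVec, hw, one_smul]
  simp only [householder, sub_mul, mul_sub, one_mul, mul_one, smul_mul_assoc, mul_smul_comm, h]
  module

lemma householder_mem_orthogonalGroup {w : ι → ℝ} (hw : w ⬝ᵥ w = 1) :
    householder w ∈ orthogonalGroup ι ℝ := by
  rw [mem_orthogonalGroup_iff, householder_transpose, householder_mul_self hw]

lemma trace_householder {w : ι → ℝ} (hw : w ⬝ᵥ w = 1) :
    (householder w).trace = Fintype.card ι - 2 := by
  simp [householder, trace_vecMulVec, hw]

lemma det_householder {w : ι → ℝ} (hw : w ⬝ᵥ w = 1) : (householder w).det = -1 := by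
  have h : householder w = 1 + replicateCol Unit (-(2 : ℝ) • w) * replicateRow Unit w := by
    rw [householder, ← vecMulVec_eq, smul_vecMulVec, neg_smul, sub_eq_add_neg]
  rw [h, det_one_add_replicateCol_mul_replicateRow, dotProduct_smul, hw]
  norm_num

/-- Since `A + 1 = A (A + 1)ᵀ`, taking determinants gives `det (A + 1) = -det (A + 1)`, so `-1` is
an eigenvalue. -/
lemma exists_mulVec_eq_neg (hA : A ∈ orthogonalGroup ι ℝ) (hdet : A.det = -1) :
    ∃ w : ι → ℝ, w ⬝ᵥ w = 1 ∧ A *ᵥ w = -w := by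
  have h : (A + 1).det = 0 := by
    have h1 : A + 1 = A * (A + 1)ᵀ := by
      rw [transpose_add, transpose_one, mul_add, mul_transpose_of_orthogonal hA, mul_one, add_comm]
    have h2 := congrArg det h1
    rw [det_mul, det_transpose, hdet] at h2
    linarith
  obtain ⟨v, hv, hAv⟩ := exists_mulVec_eq_zero_iff.2 h
  have hpos : 0 < v ⬝ᵥ v := by simpa using dotProduct_star_self_pos_iff.2 hv
  refine ⟨(√(v ⬝ᵥ v))⁻¹ • v, ?_, ?_⟩
  · rw [smul_dotProduct, dotProduct_smul, smul_eq_mul, smul_eq_mul, ← mul_assoc, ← mul_inv,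
      Real.mul_self_sqrt hpos.le, inv_mul_cancel₀ hpos.ne']
  · rw [add_mulVec, one_mulVec] at hAv
    rw [mulVec_smul, eq_neg_of_add_eq_zero_left hAv, smul_neg]

/-- A linear isometry of determinant `-1` has trace at most `n - 2`, and if equality holds it is a
reflection. -/
lemma trace_le_of_det_eq_neg_one (hA : A ∈ orthogonalGroup ι ℝ) (hdet : A.det = -1) :
    A.trace ≤ Fintype.card ι - 2 ∧ (A.trace = Fintype.card ι - 2 →
      ∃ w : ι → ℝ, w ⬝ᵥ w = 1 ∧ A = householder w) := by
  obtain ⟨w, hw, hAw⟩ := exists_mulVec_eq_neg hA hdet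
  -- Reflecting along `w` turns the eigenvalue `-1` into `1` and raises the trace by 2;
  -- Cauchy–Schwarz against the identity then bounds the trace and settles equality.
  have hq : A * householder w = A + (2 : ℝ) • vecMulVec w w := by
    simp [householder, mul_sub, mul_vecMulVec, hAw]
  have hqm : A * householder w ∈ orthogonalGroup ι ℝ :=
    mul_mem hA (householder_mem_orthogonalGroup hw)
  have htr : frobeniusPairing 1 (A * householder w) = A.trace + 2 := by
    simp [frobeniusPairing_apply, hq, trace_vecMulVec, hw]
  have h1 := frobeniusPairing_self_of_orthogonal (one_mem (orthogonalGroup ι ℝ))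
  have h2 := frobeniusPairing_self_of_orthogonal hqm
  refine ⟨?_, fun h => ⟨w, hw, ?_⟩⟩
  · have := frobeniusPairing_le h1 h2
    linarith
  · have := eq_of_frobeniusPairing_eq h1 h2 (by rw [htr, h]; ring)
    calc A = A * householder w * householder w := by
          rw [mul_assoc, householder_mul_self hw, mul_one]
      _ = householder w := by rw [← this, one_mul]

lemma frobeniusPairing_le_of_det_eq_neg_one (hR : R ∈ orthogonalGroup ι ℝ) (hdet : R.det = -1)
    (hg : g ∈ specialOrthogonalGroup ι ℝ) : frobeniusPairing R g ≤ Fintype.card ι - 2 := by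
  rw [mem_specialOrthogonalGroup_iff] at hg
  exact (trace_le_of_det_eq_neg_one (mul_mem (transpose_mem_orthogonalGroup hR) hg.1)
    (by rw [det_mul, det_transpose, hdet, hg.2, mul_one])).1

lemma frobeniusPairing_eq_iff_of_det_eq_neg_one (hR : R ∈ orthogonalGroup ι ℝ) (hdet : R.det = -1) :
    g ∈ specialOrthogonalGroup ι ℝ ∧ frobeniusPairing R g = Fintype.card ι - 2 ↔
      ∃ w : ι → ℝ, w ⬝ᵥ w = 1 ∧ g = R * householder w := by
  rw [mem_specialOrthogonalGroup_iff]
  constructor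
  · rintro ⟨hg, h⟩
    obtain ⟨w, hw, hgw⟩ := (trace_le_of_det_eq_neg_one
      (mul_mem (transpose_mem_orthogonalGroup hR) hg.1)
      (by rw [det_mul, det_transpose, hdet, hg.2, mul_one])).2 h
    exact ⟨w, hw, by rw [← hgw, ← mul_assoc, mul_transpose_of_orthogonal hR, one_mul]⟩
  · rintro ⟨w, hw, rfl⟩
    refine ⟨⟨mul_mem hR (householder_mem_orthogonalGroup hw), ?_⟩, ?_⟩
    · rw [det_mul, hdet, det_householder hw]
      norm_num
    · rw [frobeniusPairing_apply, ← mul_assoc, transpose_mul_of_orthogonal hR, one_mul,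
        trace_householder hw]

end Orthogonal

/-! ### Singular value decomposition -/

section SingularValueDecomposition

variable {ι : Type*} [Fintype ι] [DecidableEq ι]

/-- A matrix with pairwise orthogonal columns is an orthogonal matrix times a nonnegative diagonal
matrix. -/
lemma exists_orthogonal_mul_diagonal {W : Matrix ι ι ℝ} {l : ι → ℝ} (h : Wᵀ * W = diagonal l) :
    ∃ A ∈ orthogonalGroup ι ℝ, W = A * diagonal fun i => √(l i) := by
  let w : ι → EuclideanSpace ℝ ι := fun i => WithLp.toLp 2 (Wᵀ i)
  have hw (i j : ι) : inner ℝ (w i) (w j) = if i = j then l i else 0 := by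
    have hij := congrFun (congrFun h i) j
    rw [diagonal_apply] at hij
    rw [← hij, mul_apply]
    simp [w, PiLp.inner_apply, mul_comm]
  have hl (i : ι) : l i = ‖w i‖ * ‖w i‖ := by
    rw [← real_inner_self_eq_norm_mul_norm, hw, if_pos rfl]
  have hsqrt (i : ι) : √(l i) = ‖w i‖ := by rw [hl, Real.sqrt_mul_self (norm_nonneg _)]
  -- Only nonzero columns can be normalised. The remaining basis vectors are arbitrary, since they
  -- are multiplied by zero.
  obtain ⟨b, hb⟩ := Orthonormal.exists_orthonormalBasis_extension_of_card_eq (𝕜 := ℝ)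
    (E := EuclideanSpace ℝ ι) (ι := ι) (by simp) (v := fun i => ‖w i‖⁻¹ • w i)
    (s := {i | w i ≠ 0}) (by
      rw [orthonormal_iff_ite]
      rintro ⟨i, hi⟩ ⟨j, hj⟩
      simp only [Set.domRestrict_apply, inner_smul_left, inner_smul_right, hw, Subtype.mk.injEq]
      split_ifs with hij
      · subst hij
        have : ‖w i‖ ≠ 0 := norm_ne_zero_iff.2 hi
        rw [hl]
        simp
        field_simp
      · simp)
  refine ⟨of fun i j => b j i, ?_, ?_⟩
  · rw [mem_orthogonalGroup_iff']
    ext i j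
    have := orthonormal_iff_ite.1 b.orthonormal i j
    rw [one_apply, ← this, mul_apply]
    simp [PiLp.inner_apply, mul_comm]
  · ext i j
    rw [mul_diagonal, of_apply, hsqrt]
    by_cases hj : w j = 0
    · have : w j i = 0 := by rw [hj]; rfl
      rw [hj, norm_zero, mul_zero]
      exact this
    · have : ‖w j‖ ≠ 0 := norm_ne_zero_iff.2 hj
      rw [hb j hj]
      simp only [PiLp.smul_apply, smul_eq_mul]
      field_simp
      rfl

lemma exists_spectral_decomposition {H : Matrix ι ι ℝ} (hH : H.IsHermitian) :
    ∃ B ∈ orthogonalGroup ι ℝ, H = B * diagonal hH.eigenvalues * Bᵀ := by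
  refine ⟨hH.eigenvectorUnitary, hH.eigenvectorUnitary.2, ?_⟩
  conv_lhs => rw [hH.spectral_theorem]
  rw [Unitary.conjStarAlgAut_apply]
  rfl

/-- Singular value decomposition of a real square matrix. -/
theorem exists_singular_value_decomposition (C : Matrix ι ι ℝ) :
    ∃ A ∈ orthogonalGroup ι ℝ, ∃ B ∈ orthogonalGroup ι ℝ, ∃ c : ι → ℝ,
      (∀ i, 0 ≤ c i) ∧ C = A * diagonal c * Bᵀ := by
  have hH : (Cᵀ * C).IsHermitian := by
    rw [← conjTranspose_eq_transpose_of_trivial]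
    exact isHermitian_conjTranspose_mul_self C
  obtain ⟨B, hB, h⟩ := exists_spectral_decomposition hH
  -- In an eigenbasis of `Cᵀ * C` the columns of `C * B` are pairwise orthogonal.
  obtain ⟨A, hA, hCB⟩ := exists_orthogonal_mul_diagonal (W := C * B) (l := hH.eigenvalues) (by
    calc (C * B)ᵀ * (C * B) = Bᵀ * (Cᵀ * C) * B := by
          rw [transpose_mul]; simp only [Matrix.mul_assoc]
      _ = (Bᵀ * B) * diagonal hH.eigenvalues * (Bᵀ * B) := by
          conv_lhs => rw [h]
          simp only [Matrix.mul_assoc]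
      _ = diagonal hH.eigenvalues := by
          rw [transpose_mul_of_orthogonal hB, Matrix.one_mul, Matrix.mul_one])
  refine ⟨A, hA, B, hB, fun i => √(hH.eigenvalues i), fun i => Real.sqrt_nonneg _, ?_⟩
  rw [← hCB, Matrix.mul_assoc, mul_transpose_of_orthogonal hB, Matrix.mul_one]

end SingularValueDecomposition

/-! ### Convex hulls, exposed faces and supporting hyperplanes -/

section ConvexHull

variable {E : Type*} [AddCommGroup E] [Module ℝ E]

/-- If a linear functional is bounded by `c` on `s`, then the part of the convex hull of `s` where
it equals `c` is the convex hull of the corresponding part of `s`. -/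
lemma convexHull_inter_level_eq {s : Set E} (f : E →ₗ[ℝ] ℝ) {c : ℝ} (h : ∀ x ∈ s, f x ≤ c) :
    {x ∈ convexHull ℝ s | f x = c} = convexHull ℝ {x ∈ s | f x = c} := by
  refine Set.Subset.antisymm ?_ (convexHull_min (fun x hx => ⟨subset_convexHull ℝ s hx.1, hx.2⟩)
    ((convex_convexHull ℝ s).inter (convex_hyperplane f.isLinear c)))
  rintro x ⟨hx, hfx⟩
  obtain ⟨ι, _, w, z, hw, hw1, hz, rfl⟩ := mem_convexHull_iff_exists_fintype.1 hx
  -- The nonnegative deficits average to zero, so every point of positive weight is on the level.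
  have h0 : ∑ i, w i * (c - f (z i)) = 0 := by
    rw [map_sum] at hfx
    simp only [map_smul, smul_eq_mul] at hfx
    simp only [mul_sub, Finset.sum_sub_distrib, ← Finset.sum_mul, hw1, hfx]
    ring
  have h1 (i : ι) : w i * (c - f (z i)) = 0 :=
    (Finset.sum_eq_zero_iff_of_nonneg fun i _ =>
      mul_nonneg (hw i) (sub_nonneg.2 (h _ (hz i)))).1 h0 i (Finset.mem_univ i)
  have h2 : ∑ i, w i • z i = ∑ i with w i ≠ 0, w i • z i := by
    rw [Finset.sum_filter]
    refine Finset.sum_congr rfl fun i _ => ?_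
    split_ifs with hi
    · rfl
    · rw [not_not.1 hi, zero_smul]
  rw [h2]
  refine (convex_convexHull ℝ _).sum_mem (fun i _ => hw i) ?_ fun i hi => subset_convexHull ℝ _ ?_
  · rw [Finset.sum_filter_ne_zero, hw1]
  · refine ⟨hz i, ?_⟩
    have := (mul_eq_zero.1 (h1 i)).resolve_left (Finset.mem_filter.1 hi).2
    linarith

/-- In a finite-dimensional space, the convex hull of a compact set is compact. -/
theorem IsCompact.convexHull_of_finiteDimensional [TopologicalSpace E] [ContinuousAdd E]
    [ContinuousSMul ℝ E] [FiniteDimensional ℝ E] {s : Set E} (hs : IsCompact s) :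
    IsCompact (convexHull ℝ s) := by
  rcases s.eq_empty_or_nonempty with rfl | ⟨x₀, hx₀⟩
  · simp
  -- By Carathéodory `d` points suffice. Shorter combinations are padded with `x₀` at weight zero,
  -- making the hull a continuous image of a compact set.
  let d := Module.finrank ℝ E + 1
  have h : convexHull ℝ s = (fun p : (Fin d → ℝ) × (Fin d → E) => ∑ i, p.1 i • p.2 i) ''
      (stdSimplex ℝ (Fin d) ×ˢ Set.univ.pi fun _ => s) := by
    refine Set.Subset.antisymm (fun x hx => ?_) ?_
    · obtain ⟨ι, _, z, w, hz, hind, hw, hw1, rfl⟩ := eq_pos_convex_span_of_mem_convexHull hx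
      have hcard : Fintype.card ι ≤ Fintype.card (Fin d) := by
        rw [Fintype.card_fin]
        exact hind.card_le_finrank_succ.trans
          (Nat.add_le_add_right (Submodule.finrank_le _) 1)
      obtain ⟨e⟩ := Function.Embedding.nonempty_of_card_le hcard
      refine ⟨(Function.extend e w 0, Function.extend e z fun _ => x₀), ⟨⟨fun i => ?_, ?_⟩, ?_⟩, ?_⟩
      · by_cases hi : ∃ a, e a = i
        · obtain ⟨a, rfl⟩ := hi
          simpa [e.injective.extend_apply] using (hw a).le
        · simp [Function.extend_apply' _ _ _ hi]
      · rw [← hw1]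
        refine (Fintype.sum_of_injective e e.injective _ _ (fun i hi => ?_) fun a => ?_).symm
        · exact Function.extend_apply' _ _ _ hi
        · exact (e.injective.extend_apply _ _ _).symm
      · intro i _
        by_cases hi : ∃ a, e a = i
        · obtain ⟨a, rfl⟩ := hi
          simpa [e.injective.extend_apply] using hz (Set.mem_range_self a)
        · simpa [Function.extend_apply' _ _ _ hi] using hx₀
      · refine (Fintype.sum_of_injective e e.injective _ _ (fun i hi => ?_) fun a => ?_).symm
        · simp [Function.extend_apply' _ _ _ hi]
        · simp [e.injective.extend_apply]
    · rintro _ ⟨⟨w, z⟩, ⟨hw, hz⟩, rfl⟩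
      exact (convex_convexHull ℝ s).sum_mem (fun i _ => hw.1 i) hw.2
        fun i _ => subset_convexHull ℝ s (hz i (Set.mem_univ i))
  rw [h]
  refine ((isCompact_stdSimplex ℝ _).prod (isCompact_univ_pi fun _ => hs)).image ?_
  fun_prop

/-- The points of `K` where a linear functional attains an upper bound form a face. -/
lemma isConvexFace_level [TopologicalSpace E] {K : Set E} (hK : Convex ℝ K) (hKc : IsClosed K)
    (f : E →ₗ[ℝ] ℝ) (hf : Continuous f) {c : ℝ} (h : ∀ x ∈ K, f x ≤ c) :
    IsConvexFace K {x ∈ K | f x = c} := by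
  refine ⟨hKc.inter (isClosed_eq hf continuous_const), hK.inter (convex_hyperplane f.isLinear c),
    fun x hx => hx.1, ?_⟩
  rintro x hx y hy z ⟨_, hz⟩ ⟨a, b, ha, hb, hab, rfl⟩
  refine ⟨hx, le_antisymm (h x hx) ?_⟩
  rw [map_add, map_smul, map_smul, smul_eq_mul, smul_eq_mul] at hz
  have := mul_le_mul_of_nonneg_left (h y hy) hb.le
  refine le_of_mul_le_mul_left (a := a) ?_ ha
  calc a * c = (a + b) * c - b * c := by ring
    _ ≤ a * f x := by rw [hab, one_mul]; linarith

/-- A nonempty proper extreme convex subset of a convex set with nonempty interior lies in a supporting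
hyperplane. -/
lemma IsExtreme.exists_supporting [TopologicalSpace E] [IsTopologicalAddGroup E]
    [ContinuousSMul ℝ E] {K T : Set E} (hK : Convex ℝ K) (hint : (interior K).Nonempty)
    (hT : Convex ℝ T) (hTne : T.Nonempty) (hext : IsExtreme ℝ K T) (hne : T ≠ K) :
    ∃ f : E →L[ℝ] ℝ, f ≠ 0 ∧ ∀ x ∈ T, ∀ y ∈ K, f y ≤ f x := by
  obtain ⟨t, ht⟩ := hTne
  -- If `x ∈ T` were interior, any `y ∈ K` could be prolonged through `x` to a point of `K` beyond
  -- it; extremality would put `y` in `T`, giving `T = K`.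
  have hdisj : Disjoint (interior K) T := by
    refine Set.disjoint_left.2 fun x hx hxT => hne (hext.1.antisymm fun y hy => ?_)
    have hc : Filter.Tendsto (fun ε : ℝ => x + ε • (x - y)) (nhdsWithin 0 (Set.Ioi 0)) (nhds x) := by
      have : Continuous fun ε : ℝ => x + ε • (x - y) := by fun_prop
      simpa using (this.tendsto 0).mono_left nhdsWithin_le_nhds
    obtain ⟨ε, hε, hε0⟩ := ((hc.eventually (mem_interior_iff_mem_nhds.1 hx)).and
      self_mem_nhdsWithin).exists
    replace hε0 : 0 < ε := hε0
    refine hext.2 hy hε hxT ⟨ε / (1 + ε), 1 / (1 + ε), by positivity, by positivity,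
      by field_simp; ring, ?_⟩
    match_scalars <;> field_simp
    ring
  obtain ⟨f, u, hfK, hfT⟩ := geometric_hahn_banach_open hK.interior isOpen_interior hT hdisj
  have hle : ∀ y ∈ K, f y ≤ u := by
    have : closure (interior K) ⊆ {y | f y ≤ u} :=
      closure_minimal (fun y hy => (hfK y hy).le) (isClosed_le f.continuous continuous_const)
    rw [hK.closure_interior_eq_closure_of_nonempty_interior hint] at this
    exact subset_closure.trans this
  refine ⟨f, ?_, fun x hx y hy => (hle y hy).trans (hfT x hx)⟩
  rintro rfl
  obtain ⟨x, hx⟩ := hint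
  have h1 := hfK x hx
  have h2 := hfT t ht
  simp only [_root_.zero_apply] at h1 h2
  linarith

end ConvexHull

/-! ### The two families of facet normals -/

section Normals

variable {n : ℕ}

lemma householder_single (i : Fin n) :
    householder (Pi.single i (1 : ℝ)) = diagonal fun k => if k = i then -1 else 1 := by
  ext k l
  simp only [householder, Matrix.sub_apply, one_apply, Matrix.smul_apply, vecMulVec_apply, diagonal_apply,
    Pi.single_apply, smul_eq_mul]
  split_ifs <;> simp_all
  norm_num

lemma single_dotProduct_single (i : Fin n) :
    (Pi.single i (1 : ℝ) : Fin n → ℝ) ⬝ᵥ Pi.single i 1 = 1 := by simp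

lemma permMatrix_mem_orthogonalGroup (σ : Equiv.Perm (Fin n)) :
    σ.permMatrix ℝ ∈ orthogonalGroup (Fin n) ℝ := by
  rw [mem_orthogonalGroup_iff, transpose_permMatrix, ← permMatrix_mul, inv_mul_cancel,
    permMatrix_one]

lemma permMatrix_mul_single_mul (σ : Equiv.Perm (Fin n)) (i j : Fin n) :
    σ.permMatrix ℝ * single i j 1 = single (σ.symm i) j 1 := by
  rw [Equiv.Perm.permMatrix, PEquiv.toMatrix_toPEquiv_mul]
  ext k l
  simp [single_apply, Equiv.symm_apply_eq]

/-- Matrices `v uᵀ` with `v` and `u` unit vectors, written as rotations of a matrix unit. -/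
def rankOneNormals (n : ℕ) [NeZero n] : Set (Matrix (Fin n) (Fin n) ℝ) :=
  {C | ∃ A ∈ specialOrthogonalGroup (Fin n) ℝ, ∃ B ∈ specialOrthogonalGroup (Fin n) ℝ,
    C = A * single 0 0 1 * Bᵀ}

/-- Orthogonal matrices of determinant `-1`. -/
def improperNormals (n : ℕ) : Set (Matrix (Fin n) (Fin n) ℝ) :=
  {R | R ∈ orthogonalGroup (Fin n) ℝ ∧ R.det = -1}

/-- The product sees only column 0 of `A`, so the determinant can be corrected by negating column 1.
-/
lemma exists_rotation_mul_single_eq [NeZero n] (hn : 2 ≤ n) {A : Matrix (Fin n) (Fin n) ℝ}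
    (hA : A ∈ orthogonalGroup (Fin n) ℝ) (i : Fin n) :
    ∃ A' ∈ specialOrthogonalGroup (Fin n) ℝ, A' * single 0 i 1 = A * single 0 i 1 := by
  rcases det_eq_one_or_neg_one_of_orthogonal hA with h | h
  · exact ⟨A, mem_specialOrthogonalGroup_iff.2 ⟨hA, h⟩, rfl⟩
  · let j : Fin n := ⟨1, hn⟩
    refine ⟨A * householder (Pi.single j 1), mem_specialOrthogonalGroup_iff.2
      ⟨mul_mem hA (householder_mem_orthogonalGroup (single_dotProduct_single j)), ?_⟩, ?_⟩
    · rw [det_mul, h, det_householder (single_dotProduct_single j)]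
      norm_num
    · have hj : (0 : Fin n) ≠ j := by simp [Fin.ext_iff, j]
      rw [Matrix.mul_assoc, householder_single]
      congr 1
      ext k l
      rw [diagonal_mul]
      split_ifs with hk
      · rw [hk, single_apply_of_row_ne hj, mul_zero]
      · rw [one_mul]

/-- Permutation matrices move the indices to 0, and determinants are then corrected on each side.
Thus every pair of singular vectors gives a normal, whatever the signs of `det A` and `det B`. -/
lemma mul_single_mul_mem_rankOneNormals [NeZero n] (hn : 2 ≤ n) {A B : Matrix (Fin n) (Fin n) ℝ}
    (hA : A ∈ orthogonalGroup (Fin n) ℝ) (hB : B ∈ orthogonalGroup (Fin n) ℝ) (i j : Fin n) :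
    A * single i j 1 * Bᵀ ∈ rankOneNormals n := by
  have hP (k : Fin n) := permMatrix_mem_orthogonalGroup (Equiv.swap 0 k)
  obtain ⟨A', hA', hAA'⟩ := exists_rotation_mul_single_eq hn (mul_mem hA (hP i)) 0
  obtain ⟨B', hB', hBB'⟩ := exists_rotation_mul_single_eq hn (mul_mem hB (hP j)) 0
  have hBB : single 0 0 1 * B'ᵀ = single 0 j 1 * Bᵀ := by
    rw [← transpose_inj, transpose_mul, transpose_mul, transpose_transpose, transpose_transpose,
      transpose_single, transpose_single, hBB', Matrix.mul_assoc, permMatrix_mul_single_mul,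
      Equiv.symm_swap, Equiv.swap_apply_left]
  refine ⟨A', hA', B', hB', ?_⟩
  calc A * single i j 1 * Bᵀ = A * single i 0 1 * (single 0 j 1 * Bᵀ) := by
        rw [Matrix.mul_assoc A (single i 0 1), ← Matrix.mul_assoc (single i 0 1),
          single_mul_single_same, one_mul, Matrix.mul_assoc]
    _ = A' * single 0 0 1 * (single 0 0 1 * B'ᵀ) := by
        rw [hAA', hBB, Matrix.mul_assoc A (Equiv.Perm.permMatrix ℝ _), permMatrix_mul_single_mul,
          Equiv.symm_swap, Equiv.swap_apply_left]
    _ = A' * single 0 0 1 * B'ᵀ := by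
        rw [Matrix.mul_assoc A', ← Matrix.mul_assoc (single 0 0 1), single_mul_single_same, one_mul,
          Matrix.mul_assoc]

lemma frobeniusPairing_self_of_rankOneNormals [NeZero n] {C : Matrix (Fin n) (Fin n) ℝ}
    (hC : C ∈ rankOneNormals n) : frobeniusPairing C C = 1 := by
  obtain ⟨A, hA, B, hB, rfl⟩ := hC
  rw [frobeniusPairing_mul_mul_of_orthogonal (mem_specialOrthogonalGroup_iff.1 hA).1
    (mem_specialOrthogonalGroup_iff.1 hB).1, frobeniusPairing_single, single_apply_same]

lemma frobeniusPairing_rankOneNormals_le [NeZero n] {C g : Matrix (Fin n) (Fin n) ℝ}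
    (hC : C ∈ rankOneNormals n) (hg : g ∈ orthogonalGroup (Fin n) ℝ) :
    frobeniusPairing C g ≤ 1 := by
  obtain ⟨A, hA, B, hB, rfl⟩ := hC
  exact frobeniusPairing_mul_single_mul_le (mem_specialOrthogonalGroup_iff.1 hA).1
    (mem_specialOrthogonalGroup_iff.1 hB).1 hg 0

lemma frobeniusPairing_self_of_improperNormals {R : Matrix (Fin n) (Fin n) ℝ}
    (hR : R ∈ improperNormals n) : frobeniusPairing R R = n := by
  rw [frobeniusPairing_self_of_orthogonal hR.1, Fintype.card_fin]

end Normals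

/-! ### Points of the orbitope and its interior -/

section Orbitope

variable {n : ℕ}

lemma convex_tautologicalOrbitopeSO (n : ℕ) : Convex ℝ (tautologicalOrbitopeSO n) :=
  convex_convexHull ℝ _

lemma mem_tautologicalOrbitopeSO {g : Matrix (Fin n) (Fin n) ℝ}
    (hg : g ∈ specialOrthogonalGroup (Fin n) ℝ) : g ∈ tautologicalOrbitopeSO n :=
  subset_convexHull ℝ _ hg

lemma isClosed_tautologicalOrbitopeSO (n : ℕ) : IsClosed (tautologicalOrbitopeSO n) := by
  refine IsCompact.isClosed (IsCompact.convexHull_of_finiteDimensional ?_)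
  refine IsCompact.of_isClosed_subset (isCompact_univ_pi fun i : Fin n =>
    isCompact_univ_pi fun j : Fin n => isCompact_Icc (a := (-1 : ℝ)) (b := 1)) ?_ ?_
  · have : {g : Matrix (Fin n) (Fin n) ℝ | g ∈ specialOrthogonalGroup (Fin n) ℝ}
        = {g | g * gᵀ = 1} ∩ {g | g.det = 1} := by
      ext g
      simp [mem_specialOrthogonalGroup_iff, mem_orthogonalGroup_iff]
    rw [this]
    exact (isClosed_eq (by fun_prop) continuous_const).inter
      (isClosed_eq (by fun_prop) continuous_const)
  · intro g hg i _ j _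
    exact abs_le.1 (entry_norm_bound_of_unitary (𝕜 := ℝ) (mem_specialOrthogonalGroup_iff.1 hg).1 i j)

lemma mul_mem_tautologicalOrbitopeSO {U V X : Matrix (Fin n) (Fin n) ℝ}
    (hU : U ∈ specialOrthogonalGroup (Fin n) ℝ) (hV : V ∈ specialOrthogonalGroup (Fin n) ℝ)
    (hX : X ∈ tautologicalOrbitopeSO n) : U * X * V ∈ tautologicalOrbitopeSO n := by
  let f := LinearMap.mulRight ℝ V ∘ₗ LinearMap.mulLeft ℝ U
  have h : f '' tautologicalOrbitopeSO n ⊆ tautologicalOrbitopeSO n := by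
    rw [tautologicalOrbitopeSO, LinearMap.image_convexHull]
    refine convexHull_mono ?_
    rintro _ ⟨g, hg, rfl⟩
    exact mul_mem (mul_mem hU hg) hV
  exact h ⟨X, hX, rfl⟩

lemma linear_le_of_mem_tautologicalOrbitopeSO {f : Matrix (Fin n) (Fin n) ℝ →ₗ[ℝ] ℝ} {c : ℝ}
    (h : ∀ g ∈ specialOrthogonalGroup (Fin n) ℝ, f g ≤ c) {X : Matrix (Fin n) (Fin n) ℝ}
    (hX : X ∈ tautologicalOrbitopeSO n) : f X ≤ c :=
  convexHull_min (fun g hg => h g hg) (convex_halfSpace_le f.isLinear c) hX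

/-- Negating entries `i` and `j` together is multiplication by a rotation; averaging with the
original kills both. -/
lemma diagonal_zero_pair_mem {d : Fin n → ℝ} (h : diagonal d ∈ tautologicalOrbitopeSO n)
    {i j : Fin n} (hij : i ≠ j) :
    diagonal (fun k => if k = i ∨ k = j then 0 else d k) ∈ tautologicalOrbitopeSO n := by
  have hi := single_dotProduct_single i
  have hj := single_dotProduct_single j
  have hJ : householder (Pi.single i 1) * householder (Pi.single j 1)
      ∈ specialOrthogonalGroup (Fin n) ℝ := by
    refine mem_specialOrthogonalGroup_iff.2 ⟨mul_mem (householder_mem_orthogonalGroup hi)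
      (householder_mem_orthogonalGroup hj), ?_⟩
    rw [det_mul, det_householder hi, det_householder hj]
    norm_num
  have h' := mul_mem_tautologicalOrbitopeSO hJ (one_mem _) h
  convert convex_tautologicalOrbitopeSO n h h' (a := 1 / 2) (b := 1 / 2) (by norm_num) (by norm_num)
    (by norm_num) using 1
  rw [householder_single, householder_single, Matrix.mul_one, diagonal_mul_diagonal,
    diagonal_mul_diagonal, ← diagonal_smul, ← diagonal_smul, diagonal_add]
  congr 1
  ext k
  by_cases hki : k = i
  · subst hki
    simp [hij]
  · by_cases hkj : k = j
    · subst hkj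
      simp [hki]
    · simp [hki, hkj]
      ring

/-- Entries die in pairs, but once entry `i` is zero it can be paired with any other, so further
entries can be removed singly. -/
lemma diagonal_zero_finset_mem {i j : Fin n} (hij : i ≠ j) (s : Finset (Fin n)) :
    diagonal (fun k => if k ∈ s ∨ k = i ∨ k = j then (0 : ℝ) else 1)
      ∈ tautologicalOrbitopeSO n := by
  induction s using Finset.induction_on with
  | empty =>
    have h : diagonal (fun _ => (1 : ℝ)) ∈ tautologicalOrbitopeSO n := by
      rw [diagonal_one]
      exact mem_tautologicalOrbitopeSO (one_mem _)
    simpa using diagonal_zero_pair_mem h hij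
  | insert l s _ ih =>
    by_cases hl : l = i
    · convert ih using 2
      ext k
      refine if_congr ?_ rfl rfl
      rw [Finset.mem_insert, hl]
      tauto
    · convert diagonal_zero_pair_mem ih hl using 2
      ext k
      simp only [Finset.mem_insert]
      split_ifs <;> tauto

lemma exists_ne_ne_zero [NeZero n] (hn : 3 ≤ n) : ∃ i j : Fin n, i ≠ j ∧ i ≠ 0 ∧ j ≠ 0 :=
  ⟨⟨1, by omega⟩, ⟨2, by omega⟩, by simp [Fin.ext_iff], by simp [Fin.ext_iff],
    by simp [Fin.ext_iff]⟩

lemma zero_mem_tautologicalOrbitopeSO (hn : 2 ≤ n) : 0 ∈ tautologicalOrbitopeSO n := by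
  have hij : (⟨0, by omega⟩ : Fin n) ≠ ⟨1, hn⟩ := by simp
  simpa using diagonal_zero_finset_mem hij Finset.univ

/-- The matrix unit at `(0, 0)` comes from the identity by zeroing all other diagonal entries. The
initial pair must avoid index 0, whence `n ≥ 3`; for `n = 2` the orbitope is a planar disc and the
inclusion fails. -/
lemma rankOneNormals_subset [NeZero n] (hn : 3 ≤ n) :
    rankOneNormals n ⊆ tautologicalOrbitopeSO n := by
  rintro _ ⟨A, hA, B, hB, rfl⟩
  refine mul_mem_tautologicalOrbitopeSO hA (transpose_mem_specialOrthogonalGroup hB) ?_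
  obtain ⟨i, j, hij, hi, hj⟩ := exists_ne_ne_zero hn
  convert diagonal_zero_finset_mem hij {0}ᶜ using 1
  rw [← diagonal_single]
  congr 1
  ext k
  by_cases hk : k = 0
  · subst hk
    simp [hi.symm, hj.symm]
  · simp [hk]

/-- The affine hull is everything because it contains zero and all matrix units. -/
lemma interior_tautologicalOrbitopeSO_nonempty (hn : 3 ≤ n) :
    (interior (tautologicalOrbitopeSO n)).Nonempty := by
  have : NeZero n := ⟨by omega⟩
  let _ : NormedAddCommGroup (Matrix (Fin n) (Fin n) ℝ) := Matrix.normedAddCommGroup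
  let _ : NormedSpace ℝ (Matrix (Fin n) (Fin n) ℝ) := Matrix.normedSpace
  refine interior_convexHull_nonempty_iff_affineSpan_eq_top.2 ?_
  rw [← affineSpan_convexHull]
  set S := affineSpan ℝ (convexHull ℝ {g : Matrix (Fin n) (Fin n) ℝ |
    g ∈ specialOrthogonalGroup (Fin n) ℝ}) with hS
  have hK : ∀ X ∈ tautologicalOrbitopeSO n, X ∈ S := fun X hX => subset_affineSpan ℝ _ hX
  have h0 := hK 0 (zero_mem_tautologicalOrbitopeSO (by omega))
  refine eq_top_iff.2 fun X _ => ?_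
  have hX : X ∈ S.direction := by
    rw [matrix_eq_sum_single X]
    refine Submodule.sum_mem _ fun i _ => Submodule.sum_mem _ fun j _ => ?_
    have h1 : single i j (1 : ℝ) ∈ S := hK _ (rankOneNormals_subset hn (by
      simpa using mul_single_mul_mem_rankOneNormals (by omega) (one_mem _) (one_mem _) i j))
    have h2 := S.direction.smul_mem (X i j) (AffineSubspace.vsub_mem_direction h1 h0)
    simpa [smul_single] using h2
  simpa using AffineSubspace.vadd_mem_of_mem_direction hX h0

end Orbitope

/-! ### Classification of the facets -/

section Facets

variable {n : ℕ} {C D R S : Matrix (Fin n) (Fin n) ℝ}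

/-- The part of the orbitope on which the functional `⟨C, ·⟩` takes the value `c`. -/
def orbitopeSlice (C : Matrix (Fin n) (Fin n) ℝ) (c : ℝ) : Set (Matrix (Fin n) (Fin n) ℝ) :=
  {X ∈ tautologicalOrbitopeSO n | frobeniusPairing C X = c}

lemma frobeniusPairing_rankOne_le_of_mem [NeZero n] (hC : C ∈ rankOneNormals n)
    {X : Matrix (Fin n) (Fin n) ℝ} (hX : X ∈ tautologicalOrbitopeSO n) :
    frobeniusPairing C X ≤ 1 :=
  linear_le_of_mem_tautologicalOrbitopeSO (fun _ hg =>
    frobeniusPairing_rankOneNormals_le hC (mem_specialOrthogonalGroup_iff.1 hg).1) hX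

lemma frobeniusPairing_improper_le_of_mem (hR : R ∈ improperNormals n)
    {X : Matrix (Fin n) (Fin n) ℝ} (hX : X ∈ tautologicalOrbitopeSO n) :
    frobeniusPairing R X ≤ n - 2 :=
  linear_le_of_mem_tautologicalOrbitopeSO (fun _ hg =>
    (frobeniusPairing_le_of_det_eq_neg_one hR.1 hR.2 hg).trans_eq (by rw [Fintype.card_fin])) hX

lemma isConvexFace_orbitopeSlice {c : ℝ}
    (h : ∀ X ∈ tautologicalOrbitopeSO n, frobeniusPairing C X ≤ c) :
    IsConvexFace (tautologicalOrbitopeSO n) (orbitopeSlice C c) :=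
  isConvexFace_level (convex_tautologicalOrbitopeSO n) (isClosed_tautologicalOrbitopeSO n)
    (frobeniusPairing C) (LinearMap.continuous_of_finiteDimensional _) h

lemma orbitopeSlice_ne {c : ℝ} (hn : 2 ≤ n) (hc : c ≠ 0) :
    orbitopeSlice C c ≠ tautologicalOrbitopeSO n := by
  intro h
  have h0 : (0 : Matrix (Fin n) (Fin n) ℝ) ∈ orbitopeSlice C c := by
    rw [h]
    exact zero_mem_tautologicalOrbitopeSO hn
  exact hc (by rw [← h0.2, map_zero])

lemma self_mem_orbitopeSlice [NeZero n] (hn : 3 ≤ n) (hC : C ∈ rankOneNormals n) :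
    C ∈ orbitopeSlice C 1 :=
  ⟨rankOneNormals_subset hn hC, frobeniusPairing_self_of_rankOneNormals hC⟩

lemma mul_householder_mem_orbitopeSlice (hR : R ∈ improperNormals n) {w : Fin n → ℝ}
    (hw : w ⬝ᵥ w = 1) : R * householder w ∈ orbitopeSlice R (n - 2) := by
  have h := (frobeniusPairing_eq_iff_of_det_eq_neg_one hR.1 hR.2).2 ⟨w, hw, rfl⟩
  rw [Fintype.card_fin] at h
  exact ⟨mem_tautologicalOrbitopeSO h.1, h.2⟩

lemma sum_householder_single (n : ℕ) :
    ∑ i : Fin n, householder (Pi.single i (1 : ℝ)) = ((n : ℝ) - 2) • 1 := by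
  ext k l
  rw [Matrix.sum_apply, Matrix.smul_apply, one_apply]
  simp only [householder_single, diagonal_apply]
  split_ifs with hkl
  · have h (i : Fin n) : (if k = i then (-1 : ℝ) else 1) = 1 - if k = i then 2 else 0 := by
      split_ifs <;> norm_num
    simp [h]
  · simp

/-- The average of the points `R * householder (Pi.single i 1)`. Being parallel to `R`, it tests
inclusions between slices. -/
lemma smul_mem_orbitopeSlice (hn : 2 ≤ n) (hR : R ∈ improperNormals n) :
    (((n : ℝ) - 2) / n) • R ∈ orbitopeSlice R (n - 2) := by
  have hn0 : (n : ℝ) ≠ 0 := by positivity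
  have hconv : Convex ℝ (orbitopeSlice R (n - 2)) :=
    (isConvexFace_orbitopeSlice fun _ => frobeniusPairing_improper_le_of_mem hR).2.1
  have h := hconv.sum_mem (t := Finset.univ) (w := fun _ : Fin n => (n : ℝ)⁻¹)
    (z := fun i => R * householder (Pi.single i 1)) (fun _ _ => by positivity)
    (by simp [hn0]) fun i _ => mul_householder_mem_orbitopeSlice hR (single_dotProduct_single i)
  rwa [← Finset.smul_sum, ← Finset.mul_sum, sum_householder_single, mul_smul_comm, mul_one,
    smul_smul, mul_comm, ← div_eq_mul_inv] at h

lemma rankOne_eq_of_slice_subset [NeZero n] (hn : 3 ≤ n) (hC : C ∈ rankOneNormals n)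
    (hD : D ∈ rankOneNormals n) (h : orbitopeSlice C 1 ⊆ orbitopeSlice D 1) : C = D :=
  eq_of_frobeniusPairing_eq (frobeniusPairing_self_of_rankOneNormals hC)
    (frobeniusPairing_self_of_rankOneNormals hD)
    (by rw [frobeniusPairing_comm, (h (self_mem_orbitopeSlice hn hC)).2])

lemma improper_eq_of_slice_subset (hn : 3 ≤ n) (hR : R ∈ improperNormals n)
    (hS : S ∈ improperNormals n) (h : orbitopeSlice R (n - 2) ⊆ orbitopeSlice S (n - 2)) :
    R = S := by
  have h1 := (h (smul_mem_orbitopeSlice (by omega) hR)).2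
  have hn' : (3 : ℝ) ≤ n := by exact_mod_cast hn
  rw [map_smul, smul_eq_mul, div_mul_eq_mul_div, div_eq_iff (by positivity)] at h1
  refine eq_of_frobeniusPairing_eq (frobeniusPairing_self_of_improperNormals hR)
    (frobeniusPairing_self_of_improperNormals hS) ?_
  rw [frobeniusPairing_comm]
  exact mul_left_cancel₀ (by linarith) h1

/-- Testing at `C` would give `⟨R, C⟩ = n - 2 ≥ 2`, against the bound 1. This is where `n ≥ 4` is
needed. -/
lemma not_rankOne_slice_subset_improper [NeZero n] (hn : 4 ≤ n) (hC : C ∈ rankOneNormals n)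
    (hR : R ∈ improperNormals n) : ¬ orbitopeSlice C 1 ⊆ orbitopeSlice R (n - 2) := by
  intro h
  have h1 := (h (self_mem_orbitopeSlice (by omega) hC)).2
  have h2 := frobeniusPairing_rankOneNormals_le hC hR.1
  have hn' : (4 : ℝ) ≤ n := by exact_mod_cast hn
  rw [frobeniusPairing_comm] at h1
  linarith

/-- Testing at the multiple of `R` would give `⟨C, R⟩ = n / (n - 2) > 1`. -/
lemma not_improper_slice_subset_rankOne [NeZero n] (hn : 3 ≤ n) (hC : C ∈ rankOneNormals n)
    (hR : R ∈ improperNormals n) : ¬ orbitopeSlice R (n - 2) ⊆ orbitopeSlice C 1 := by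
  intro h
  have h1 := (h (smul_mem_orbitopeSlice (by omega) hR)).2
  have h2 := frobeniusPairing_rankOneNormals_le hC hR.1
  have hn' : (3 : ℝ) ≤ n := by exact_mod_cast hn
  rw [map_smul, smul_eq_mul, div_mul_eq_mul_div, div_eq_iff (by positivity)] at h1
  nlinarith

lemma eq_one_of_sum_le {ι : Type*} [Fintype ι] {c x : ι → ℝ} (hc : ∀ i, 0 ≤ c i)
    (hx : ∀ i, x i ≤ 1) (h : ∑ i, c i ≤ ∑ i, c i * x i) {i : ι} (hi : 0 < c i) : x i = 1 := by
  have h0 : ∑ i, c i * (1 - x i) = 0 := by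
    refine le_antisymm ?_ (Finset.sum_nonneg fun i _ => mul_nonneg (hc i) (sub_nonneg.2 (hx i)))
    simp only [mul_sub, mul_one, Finset.sum_sub_distrib]
    linarith
  have h1 := (Finset.sum_eq_zero_iff_of_nonneg fun i _ =>
    mul_nonneg (hc i) (sub_nonneg.2 (hx i))).1 h0 i (Finset.mem_univ i)
  have := (mul_eq_zero.1 h1).resolve_left hi.ne'
  linarith

/-- Every nonempty set exposed by a nonzero functional lies in one of the distinguished slices. -/
lemma exists_slice_of_exposed [NeZero n] (hn : 2 ≤ n) (hC : C ≠ 0)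
    {T : Set (Matrix (Fin n) (Fin n) ℝ)} (hTK : T ⊆ tautologicalOrbitopeSO n)
    (hT : ∀ X ∈ T, ∀ Y ∈ tautologicalOrbitopeSO n, frobeniusPairing C Y ≤ frobeniusPairing C X) :
    (∃ D ∈ rankOneNormals n, T ⊆ orbitopeSlice D 1) ∨
      ∃ R ∈ improperNormals n, T ⊆ orbitopeSlice R (n - 2) := by
  obtain ⟨A, hA, B, hB, c, hc, rfl⟩ := exists_singular_value_decomposition C
  have hpair (X : Matrix (Fin n) (Fin n) ℝ) :
      frobeniusPairing (A * diagonal c * Bᵀ) X = ∑ i, c i * (Aᵀ * X * B) i i := by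
    rw [frobeniusPairing_mul_mul, frobeniusPairing_diagonal]
  have hD (i : Fin n) := mul_single_mul_mem_rankOneNormals hn hA hB i i
  have hDX (i : Fin n) (X : Matrix (Fin n) (Fin n) ℝ) :
      frobeniusPairing (A * single i i 1 * Bᵀ) X = (Aᵀ * X * B) i i := by
    rw [frobeniusPairing_mul_mul, frobeniusPairing_single]
  have hle : ∀ X ∈ T, ∀ i, (Aᵀ * X * B) i i ≤ 1 := fun X hX i => by
    rw [← hDX]
    exact frobeniusPairing_rankOne_le_of_mem (hD i) (hTK hX)
  have hpos : ∃ i, 0 < c i := by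
    by_contra! h
    have h0 : c = 0 := funext fun i => le_antisymm (h i) (hc i)
    exact hC (by simp [h0])
  have key (h : ∀ X ∈ T, ∑ i, c i ≤ ∑ i, c i * (Aᵀ * X * B) i i) :
      ∃ D ∈ rankOneNormals n, T ⊆ orbitopeSlice D 1 := by
    obtain ⟨i, hi⟩ := hpos
    refine ⟨_, hD i, fun X hX => ⟨hTK hX, ?_⟩⟩
    rw [hDX]
    exact eq_one_of_sum_le (x := fun i => (Aᵀ * X * B) i i) hc (hle X hX) (h X hX) hi
  have hcancel (M : Matrix (Fin n) (Fin n) ℝ) : Aᵀ * (A * M * Bᵀ) * B = M := by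
    calc Aᵀ * (A * M * Bᵀ) * B = (Aᵀ * A) * M * (Bᵀ * B) := by simp only [Matrix.mul_assoc]
      _ = M := by
        rw [transpose_mul_of_orthogonal hA, transpose_mul_of_orthogonal hB, Matrix.one_mul,
          Matrix.mul_one]
  have hAB : A * Bᵀ ∈ orthogonalGroup (Fin n) ℝ := mul_mem hA (transpose_mem_orthogonalGroup hB)
  rcases det_eq_one_or_neg_one_of_orthogonal hAB with hdet | hdet
  · refine Or.inl (key fun X hX => ?_)
    have h := hT X hX _ (mem_tautologicalOrbitopeSO (mem_specialOrthogonalGroup_iff.2 ⟨hAB, hdet⟩))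
    have hone := hcancel 1
    rw [Matrix.mul_one] at hone
    rw [hpair, hpair, hone] at h
    simpa using h
  -- `A Bᵀ` is not available as a test point; the cheapest way to repair its determinant is to flip
  -- the smallest singular value.
  · obtain ⟨k, hk⟩ := Finite.exists_min c
    have hR : A * Bᵀ ∈ improperNormals n := ⟨hAB, hdet⟩
    have hw := single_dotProduct_single k
    have hg : A * householder (Pi.single k 1) * Bᵀ ∈ specialOrthogonalGroup (Fin n) ℝ := by
      refine mem_specialOrthogonalGroup_iff.2 ⟨mul_mem (mul_mem hA
        (householder_mem_orthogonalGroup hw)) (transpose_mem_orthogonalGroup hB), ?_⟩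
      rw [det_mul] at hdet
      rw [det_mul, det_mul, det_householder hw, mul_right_comm, hdet]
      norm_num
    have hsum : ∀ X ∈ T, ∑ i, c i - 2 * c k ≤ ∑ i, c i * (Aᵀ * X * B) i i := fun X hX => by
      have h := hT X hX _ (mem_tautologicalOrbitopeSO hg)
      rw [hpair, hpair, hcancel, householder_single] at h
      refine le_trans (le_of_eq ?_) h
      have h' (i : Fin n) : c i * diagonal (fun j => if j = k then (-1 : ℝ) else 1) i i
          = c i - if i = k then 2 * c k else 0 := by
        rw [diagonal_apply_eq]
        split_ifs with hik
        · rw [hik]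
          ring
        · ring
      simp only [h']
      simp
    rcases (hc k).eq_or_lt with hk0 | hk0
    · refine Or.inl (key fun X hX => ?_)
      simpa [← hk0] using hsum X hX
    · refine Or.inr ⟨_, hR, fun X hX => ⟨hTK hX, ?_⟩⟩
      have htr : frobeniusPairing (A * Bᵀ) X = ∑ i, (Aᵀ * X * B) i i := by
        rw [← Matrix.mul_one A, frobeniusPairing_mul_mul, Matrix.mul_one]
        simp [frobeniusPairing_apply, Matrix.trace]
      refine le_antisymm (frobeniusPairing_improper_le_of_mem hR (hTK hX)) ?_
      -- Subtracting this from `hsum` leaves `c k * (n - 2) ≤ c k * ∑ x i`, with `x i` the diagonal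
      -- entries.
      have h1 : ∑ i, (c i - c k) * (Aᵀ * X * B) i i ≤ ∑ i, (c i - c k) :=
        Finset.sum_le_sum fun i _ =>
          mul_le_of_le_one_right (sub_nonneg.2 (hk i)) (hle X hX i)
      simp only [sub_mul, Finset.sum_sub_distrib, ← Finset.mul_sum, ← htr, Finset.sum_const,
        Finset.card_univ, Fintype.card_fin, nsmul_eq_mul] at h1
      refine le_of_mul_le_mul_left (a := c k) ?_ hk0
      have := hsum X hX
      linarith

lemma exists_slice_of_isConvexFace [NeZero n] (hn : 3 ≤ n) {T : Set (Matrix (Fin n) (Fin n) ℝ)}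
    (hT : IsConvexFace (tautologicalOrbitopeSO n) T) (hne : T ≠ tautologicalOrbitopeSO n) :
    (∃ D ∈ rankOneNormals n, T ⊆ orbitopeSlice D 1) ∨
      ∃ R ∈ improperNormals n, T ⊆ orbitopeSlice R (n - 2) := by
  rcases T.eq_empty_or_nonempty with rfl | hTne
  -- The empty face has no supporting functional to use, but lies in any slice.
  · exact Or.inl ⟨_, ⟨1, one_mem _, 1, one_mem _, rfl⟩, Set.empty_subset _⟩
  · obtain ⟨f, hf0, hf⟩ := hT.2.2.exists_supporting (convex_tautologicalOrbitopeSO n)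
      (interior_tautologicalOrbitopeSO_nonempty hn) hT.2.1 hTne hne
    obtain ⟨C, hC⟩ := exists_eq_frobeniusPairing (f : Matrix (Fin n) (Fin n) ℝ →ₗ[ℝ] ℝ)
    have hfC (X : Matrix (Fin n) (Fin n) ℝ) : f X = frobeniusPairing C X := by
      rw [← hC]
      rfl
    refine exists_slice_of_exposed (C := C) (by omega) ?_ hT.2.2.1 ?_
    · rintro rfl
      refine hf0 (ContinuousLinearMap.ext fun X => ?_)
      rw [hfC]
      simp [frobeniusPairing_apply]
    · simpa only [hfC] using hf

/-- The facets of the tautological orbitope of `SO(n)`. -/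
theorem isConvexFacet_tautologicalOrbitopeSO_iff [NeZero n] (hn : 4 ≤ n)
    {T : Set (Matrix (Fin n) (Fin n) ℝ)} :
    IsConvexFacet (tautologicalOrbitopeSO n) T ↔
      (∃ C ∈ rankOneNormals n, T = orbitopeSlice C 1) ∨
        ∃ R ∈ improperNormals n, T = orbitopeSlice R (n - 2) := by
  have hn' : (4 : ℝ) ≤ n := by exact_mod_cast hn
  have hface₁ : ∀ C ∈ rankOneNormals n,
      IsConvexFace (tautologicalOrbitopeSO n) (orbitopeSlice C 1) ∧
        orbitopeSlice C 1 ≠ tautologicalOrbitopeSO n := fun C hC =>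
    ⟨isConvexFace_orbitopeSlice fun _ => frobeniusPairing_rankOne_le_of_mem hC,
      orbitopeSlice_ne (by omega) one_ne_zero⟩
  have hface₂ : ∀ R ∈ improperNormals n,
      IsConvexFace (tautologicalOrbitopeSO n) (orbitopeSlice R (n - 2)) ∧
        orbitopeSlice R (n - 2) ≠ tautologicalOrbitopeSO n := fun R hR =>
    ⟨isConvexFace_orbitopeSlice fun _ => frobeniusPairing_improper_le_of_mem hR,
      orbitopeSlice_ne (by omega) (by linarith)⟩
  constructor
  · intro hT
    rcases exists_slice_of_isConvexFace (by omega) hT.prop.1 hT.prop.2 with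
      ⟨C, hC, h⟩ | ⟨R, hR, h⟩
    · exact Or.inl ⟨C, hC, hT.eq_of_subset (hface₁ C hC) h⟩
    · exact Or.inr ⟨R, hR, hT.eq_of_subset (hface₂ R hR) h⟩
  · rintro (⟨C, hC, rfl⟩ | ⟨R, hR, rfl⟩)
    · refine ⟨hface₁ C hC, fun T hT hCT => ?_⟩
      rcases exists_slice_of_isConvexFace (by omega) hT.1 hT.2 with ⟨D, hD, h⟩ | ⟨R, hR, h⟩
      · rwa [rankOne_eq_of_slice_subset (by omega) hC hD (hCT.trans h)]
      · exact absurd (hCT.trans h) (not_rankOne_slice_subset_improper hn hC hR)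
    · refine ⟨hface₂ R hR, fun T hT hRT => ?_⟩
      rcases exists_slice_of_isConvexFace (by omega) hT.1 hT.2 with ⟨C, hC, h⟩ | ⟨S, hS, h⟩
      · exact absurd (hRT.trans h) (not_improper_slice_subset_rankOne (by omega) hC hR)
      · rwa [improper_eq_of_slice_subset (by omega) hR hS (hRT.trans h)]

end Facets

/-! ### Transitivity on each family -/

section Orbits

variable {n : ℕ} {C R : Matrix (Fin n) (Fin n) ℝ}

lemma rotation_image_orbitopeSlice {U V : Matrix (Fin n) (Fin n) ℝ}
    (hU : U ∈ specialOrthogonalGroup (Fin n) ℝ) (hV : V ∈ specialOrthogonalGroup (Fin n) ℝ)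
    (C : Matrix (Fin n) (Fin n) ℝ) (c : ℝ) :
    (fun X => U * X * Vᵀ) '' orbitopeSlice C c = orbitopeSlice (U * C * Vᵀ) c := by
  have hU' := (mem_specialOrthogonalGroup_iff.1 hU).1
  have hV' := (mem_specialOrthogonalGroup_iff.1 hV).1
  refine Set.Subset.antisymm ?_ fun X hX => ⟨Uᵀ * X * V, ⟨?_, ?_⟩, ?_⟩
  · rintro _ ⟨X, hX, rfl⟩
    refine ⟨mul_mem_tautologicalOrbitopeSO hU (transpose_mem_specialOrthogonalGroup hV) hX.1, ?_⟩
    rw [frobeniusPairing_mul_mul_of_orthogonal hU' hV', hX.2]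
  · exact mul_mem_tautologicalOrbitopeSO (transpose_mem_specialOrthogonalGroup hU) hV hX.1
  · rw [← frobeniusPairing_mul_mul, hX.2]
  · calc U * (Uᵀ * X * V) * Vᵀ = (U * Uᵀ) * X * (V * Vᵀ) := by simp only [Matrix.mul_assoc]
      _ = X := by
        rw [mul_transpose_of_orthogonal hU', mul_transpose_of_orthogonal hV', Matrix.one_mul,
          Matrix.mul_one]

lemma rotationOrbit_rankOne_slice [NeZero n] (hC : C ∈ rankOneNormals n) :
    rotationOrbit n (orbitopeSlice C 1) = {T | ∃ D ∈ rankOneNormals n, T = orbitopeSlice D 1} := by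
  obtain ⟨A, hA, B, hB, rfl⟩ := hC
  ext T
  constructor
  · rintro ⟨U, hU, V, hV, rfl⟩
    refine ⟨_, ⟨U * A, mul_mem hU hA, V * B, mul_mem hV hB, rfl⟩, ?_⟩
    rw [rotation_image_orbitopeSlice hU hV, transpose_mul]
    simp only [Matrix.mul_assoc]
  · rintro ⟨_, ⟨A', hA', B', hB', rfl⟩, rfl⟩
    have hU := mul_mem hA' (transpose_mem_specialOrthogonalGroup hA)
    have hV := mul_mem hB' (transpose_mem_specialOrthogonalGroup hB)
    refine ⟨_, hU, _, hV, ?_⟩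
    rw [rotation_image_orbitopeSlice hU hV]
    congr 1
    symm
    calc A' * Aᵀ * (A * single 0 0 1 * Bᵀ) * (B' * Bᵀ)ᵀ
        = A' * (Aᵀ * A) * single 0 0 1 * (Bᵀ * B) * B'ᵀ := by
          rw [transpose_mul, transpose_transpose]
          simp only [Matrix.mul_assoc]
      _ = A' * single 0 0 1 * B'ᵀ := by
          rw [transpose_mul_of_orthogonal (mem_specialOrthogonalGroup_iff.1 hA).1,
            transpose_mul_of_orthogonal (mem_specialOrthogonalGroup_iff.1 hB).1, Matrix.mul_one,
            Matrix.mul_one]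

lemma rotationOrbit_improper_slice (hR : R ∈ improperNormals n) (c : ℝ) :
    rotationOrbit n (orbitopeSlice R c) = {T | ∃ S ∈ improperNormals n, T = orbitopeSlice S c} := by
  ext T
  constructor
  · rintro ⟨U, hU, V, hV, rfl⟩
    refine ⟨U * R * Vᵀ, ?_, rotation_image_orbitopeSlice hU hV R c⟩
    rw [mem_specialOrthogonalGroup_iff] at hU hV
    refine ⟨mul_mem (mul_mem hU.1 hR.1) (transpose_mem_orthogonalGroup hV.1), ?_⟩
    rw [det_mul, det_mul, det_transpose, hU.2, hV.2, hR.2]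
    norm_num
  · rintro ⟨S, hS, rfl⟩
    have hU : S * Rᵀ ∈ specialOrthogonalGroup (Fin n) ℝ := by
      refine mem_specialOrthogonalGroup_iff.2
        ⟨mul_mem hS.1 (transpose_mem_orthogonalGroup hR.1), ?_⟩
      rw [det_mul, det_transpose, hS.2, hR.2]
      norm_num
    refine ⟨_, hU, 1, one_mem _, ?_⟩
    rw [rotation_image_orbitopeSlice hU (one_mem _), transpose_one, Matrix.mul_one,
      Matrix.mul_assoc, transpose_mul_of_orthogonal hR.1, Matrix.mul_one]

end Orbits

/-! ### Invariance of dimension -/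

section AffineIsomorphism

variable {E F : Type*} [AddCommGroup E] [Module ℝ E] [AddCommGroup F] [Module ℝ F]

lemma convexDim_image {f : E →ᵃ[ℝ] F} (hf : Function.Injective f) (S : Set E) :
    convexDim (f '' S) = convexDim S := by
  rw [convexDim, convexDim, direction_affineSpan, direction_affineSpan, ← AffineMap.map_vectorSpan]
  exact (Submodule.equivMapOfInjective _ (f.linear_injective_iff.2 hf) _).finrank_eq.symm

end AffineIsomorphism

/-! ### The free spectrahedron and its dimension -/

section FreeSpectrahedron

variable {n : ℕ}

lemma mul_diagonal_mul_transpose (B : Matrix (Fin n) (Fin n) ℝ) (c : Fin n → ℝ) :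
    B * diagonal c * Bᵀ = ∑ i, c i • vecMulVec (B.col i) (B.col i) := by
  ext k l
  simp only [Matrix.sum_apply, Matrix.smul_apply, vecMulVec_apply, mul_apply (M := B * _),
    mul_diagonal, transpose_apply, smul_eq_mul, col_apply]
  exact Finset.sum_congr rfl fun i _ => by ring

lemma col_dotProduct_col {B : Matrix (Fin n) (Fin n) ℝ} (hB : B ∈ orthogonalGroup (Fin n) ℝ)
    (i : Fin n) : B.col i ⬝ᵥ B.col i = 1 := by
  have h := congrFun (congrFun (transpose_mul_of_orthogonal hB) i) i
  rwa [one_apply_eq] at h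

lemma trace_mul_diagonal_mul_transpose {B : Matrix (Fin n) (Fin n) ℝ}
    (hB : B ∈ orthogonalGroup (Fin n) ℝ) (c : Fin n → ℝ) :
    (B * diagonal c * Bᵀ).trace = ∑ i, c i := by
  rw [trace_mul_cycle, transpose_mul_of_orthogonal hB, Matrix.one_mul, trace_diagonal]

lemma vecMulVec_self_mem_freeSpectrahedron {w : Fin n → ℝ} (hw : w ⬝ᵥ w = 1) :
    vecMulVec w w ∈ freeSpectrahedron n := by
  refine ⟨?_, by rw [trace_vecMulVec, hw]⟩
  simpa using posSemidef_vecMulVec_self_star w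

/-- The free spectrahedron is the convex hull of the rank one orthogonal projections. -/
theorem convexHull_vecMulVec_eq_freeSpectrahedron (n : ℕ) :
    convexHull ℝ {P | ∃ w : Fin n → ℝ, w ⬝ᵥ w = 1 ∧ P = vecMulVec w w} = freeSpectrahedron n := by
  refine Set.Subset.antisymm (convexHull_min ?_ ?_) fun X hX => ?_
  · rintro _ ⟨w, hw, rfl⟩
    exact vecMulVec_self_mem_freeSpectrahedron hw
  · intro X hX Y hY a b ha hb hab
    refine ⟨(hX.1.smul ha).add (hY.1.smul hb), ?_⟩
    rw [trace_add, trace_smul, trace_smul, hX.2, hY.2, smul_eq_mul, smul_eq_mul, mul_one, mul_one,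
      hab]
  · obtain ⟨B, hB, h⟩ := exists_spectral_decomposition hX.1.isHermitian
    have htr := hX.2
    rw [h, trace_mul_diagonal_mul_transpose hB] at htr
    rw [h, mul_diagonal_mul_transpose]
    exact (convex_convexHull ℝ _).sum_mem (fun i _ => hX.1.eigenvalues_nonneg i) htr
      fun i _ => subset_convexHull ℝ _ ⟨_, col_dotProduct_col hB i, rfl⟩

/-- Symmetric matrices as functions on unordered pairs of indices. -/
def sym2ToMatrix (n : ℕ) : (Sym2 (Fin n) → ℝ) →ₗ[ℝ] Matrix (Fin n) (Fin n) ℝ where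
  toFun g := of fun i j => g s(i, j)
  map_add' _ _ := rfl
  map_smul' _ _ := rfl

lemma sym2ToMatrix_injective (n : ℕ) : Function.Injective (sym2ToMatrix n) := by
  intro g h hgh
  ext p
  induction p using Sym2.ind with
  | _ i j => exact congrFun (congrFun hgh i) j

lemma exists_sym2ToMatrix_eq {X : Matrix (Fin n) (Fin n) ℝ} (hX : X.IsHermitian) :
    ∃ g, sym2ToMatrix n g = X := by
  refine ⟨fun p => Sym2.lift ⟨fun i j => X i j, fun i j => ?_⟩ p, rfl⟩
  simpa using hX.apply j i

lemma isHermitian_sym2ToMatrix (g : Sym2 (Fin n) → ℝ) : (sym2ToMatrix n g).IsHermitian := by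
  ext i j
  exact congrArg g Sym2.eq_swap

lemma vectorSpan_freeSpectrahedron [NeZero n] :
    vectorSpan ℝ (freeSpectrahedron n)
      = (LinearMap.ker (traceLinearMap (Fin n) ℝ ℝ ∘ₗ sym2ToMatrix n)).map (sym2ToMatrix n) := by
  refine le_antisymm (Submodule.span_le.2 ?_) ?_
  · rintro _ ⟨X, hX, Y, hY, rfl⟩
    obtain ⟨g, hg⟩ := exists_sym2ToMatrix_eq (hX.1.isHermitian.sub hY.1.isHermitian)
    refine ⟨g, ?_, hg⟩
    simp [hg, hX.2, hY.2]
  · rintro _ ⟨g, hg, rfl⟩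
    have hH := isHermitian_sym2ToMatrix g
    obtain ⟨B, hB, h⟩ := exists_spectral_decomposition hH
    have htr : (sym2ToMatrix n g).trace = 0 := hg
    rw [h, trace_mul_diagonal_mul_transpose hB] at htr
    -- The eigenvalues sum to zero, so one fixed projection can be subtracted from every term.
    have hsum : sym2ToMatrix n g = ∑ i, hH.eigenvalues i •
        (vecMulVec (B.col i) (B.col i) - vecMulVec (B.col 0) (B.col 0)) := by
      simp only [smul_sub, Finset.sum_sub_distrib, ← Finset.sum_smul, htr, zero_smul, sub_zero]
      rw [← mul_diagonal_mul_transpose, ← h]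
    rw [hsum]
    exact Submodule.sum_mem _ fun i _ => Submodule.smul_mem _ _ (vsub_mem_vectorSpan ℝ
      (vecMulVec_self_mem_freeSpectrahedron (col_dotProduct_col hB i))
      (vecMulVec_self_mem_freeSpectrahedron (col_dotProduct_col hB 0)))

/-- Unordered pairs of indices number `(n + 1).choose 2`; the nonzero trace functional removes one
dimension. -/
theorem convexDim_freeSpectrahedron [NeZero n] :
    convexDim (freeSpectrahedron n) = (n + 1).choose 2 - 1 := by
  rw [convexDim, direction_affineSpan, vectorSpan_freeSpectrahedron,
    ← (Submodule.equivMapOfInjective _ (sym2ToMatrix_injective n) _).finrank_eq]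
  have hne : traceLinearMap (Fin n) ℝ ℝ ∘ₗ sym2ToMatrix n ≠ 0 := by
    obtain ⟨g, hg⟩ := exists_sym2ToMatrix_eq (isHermitian_one (n := Fin n) (α := ℝ))
    intro h
    have h1 := LinearMap.congr_fun h g
    simp [hg, NeZero.ne n] at h1
  have h := Module.Dual.finrank_ker_add_one_of_ne_zero hne
  rw [Module.finrank_fintype_fun_eq_card, Sym2.card, Fintype.card_fin] at h
  exact Nat.eq_sub_of_add_eq h

end FreeSpectrahedron

/-! ### Facets with improper normal -/

section ReflectionFacet

variable {n : ℕ} {R : Matrix (Fin n) (Fin n) ℝ}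

/-- The affine map sending `R (1 - 2 w wᵀ)` to `w wᵀ`, for `R` orthogonal. -/
noncomputable def reflectionChart (R : Matrix (Fin n) (Fin n) ℝ) :
    Matrix (Fin n) (Fin n) ℝ →ᵃ[ℝ] Matrix (Fin n) (Fin n) ℝ :=
  (-(1 / 2 : ℝ) • LinearMap.mulLeft ℝ Rᵀ).toAffineMap + AffineMap.const ℝ _ ((1 / 2 : ℝ) • 1)

lemma reflectionChart_apply (R X : Matrix (Fin n) (Fin n) ℝ) :
    reflectionChart R X = -(1 / 2 : ℝ) • (Rᵀ * X) + (1 / 2 : ℝ) • 1 := rfl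

lemma reflectionChart_injective (hR : R ∈ orthogonalGroup (Fin n) ℝ) :
    Function.Injective (reflectionChart R) := by
  intro X Y h
  rw [reflectionChart_apply, reflectionChart_apply] at h
  have h1 := smul_right_injective _ (by norm_num : -(1 / 2 : ℝ) ≠ 0) (add_right_cancel h)
  have h2 := congrArg (R * ·) h1
  simpa only [← Matrix.mul_assoc, mul_transpose_of_orthogonal hR, Matrix.one_mul] using h2

lemma reflectionChart_mul_householder (hR : R ∈ orthogonalGroup (Fin n) ℝ) (w : Fin n → ℝ) :
    reflectionChart R (R * householder w) = vecMulVec w w := by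
  rw [reflectionChart_apply, ← Matrix.mul_assoc, transpose_mul_of_orthogonal hR, Matrix.one_mul,
    householder]
  module

lemma reflectionChart_image_slice (hR : R ∈ improperNormals n) :
    reflectionChart R '' orbitopeSlice R (n - 2) = freeSpectrahedron n := by
  rw [orbitopeSlice, tautologicalOrbitopeSO, convexHull_inter_level_eq, AffineMap.image_convexHull,
    ← convexHull_vecMulVec_eq_freeSpectrahedron]
  · congr 1
    have h (g : Matrix (Fin n) (Fin n) ℝ) :=
      frobeniusPairing_eq_iff_of_det_eq_neg_one (g := g) hR.1 hR.2
    rw [Fintype.card_fin] at h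
    ext P
    constructor
    · rintro ⟨g, hg, rfl⟩
      obtain ⟨w, hw, rfl⟩ := (h g).1 hg
      exact ⟨w, hw, reflectionChart_mul_householder hR.1 w⟩
    · rintro ⟨w, hw, rfl⟩
      exact ⟨_, (h _).2 ⟨w, hw, rfl⟩, reflectionChart_mul_householder hR.1 w⟩
  · exact fun g hg => frobeniusPairing_improper_le_of_mem hR (mem_tautologicalOrbitopeSO hg)

lemma improper_slice_affinelyIsomorphic (hR : R ∈ improperNormals n) :
    AffinelyIsomorphic (orbitopeSlice R (n - 2)) (freeSpectrahedron n) :=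
  ⟨reflectionChart R, (reflectionChart_injective hR.1).injOn, reflectionChart_image_slice hR⟩

lemma convexDim_improper_slice [NeZero n] (hR : R ∈ improperNormals n) :
    convexDim (orbitopeSlice R (n - 2)) = (n + 1).choose 2 - 1 := by
  rw [← convexDim_freeSpectrahedron, ← reflectionChart_image_slice hR,
    convexDim_image (reflectionChart_injective hR.1)]

end ReflectionFacet

/-! ### Facets with rank one normal -/

section StabilizerFacet

variable {m : ℕ}

/-- The block diagonal matrix `1 ⊕ Y`. -/
def oneBlock (Y : Matrix (Fin m) (Fin m) ℝ) : Matrix (Fin (m + 1)) (Fin (m + 1)) ℝ :=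
  of fun i j => Fin.cases (Fin.cases 1 (fun _ => 0) j) (fun k => Fin.cases 0 (fun l => Y k l) j) i

/-- Deletion of the first row and column. -/
def minorMap (m : ℕ) : Matrix (Fin (m + 1)) (Fin (m + 1)) ℝ →ₗ[ℝ] Matrix (Fin m) (Fin m) ℝ where
  toFun X := X.submatrix Fin.succ Fin.succ
  map_add' _ _ := rfl
  map_smul' _ _ := rfl

lemma minorMap_oneBlock (Y : Matrix (Fin m) (Fin m) ℝ) : minorMap m (oneBlock Y) = Y := rfl

lemma oneBlock_mul_oneBlock (X Y : Matrix (Fin m) (Fin m) ℝ) :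
    oneBlock X * oneBlock Y = oneBlock (X * Y) := by
  ext i j
  cases i using Fin.cases <;> cases j using Fin.cases <;>
    simp [oneBlock, mul_apply, Fin.sum_univ_succ]

lemma oneBlock_transpose (Y : Matrix (Fin m) (Fin m) ℝ) : (oneBlock Y)ᵀ = oneBlock Yᵀ := by
  ext i j
  cases i using Fin.cases <;> cases j using Fin.cases <;> simp [oneBlock]

lemma oneBlock_one : oneBlock (1 : Matrix (Fin m) (Fin m) ℝ) = 1 := by
  ext i j
  cases i using Fin.cases <;> cases j using Fin.cases <;>
    simp [oneBlock, one_apply, Fin.succ_ne_zero, (Fin.succ_ne_zero _).symm]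

lemma det_oneBlock (Y : Matrix (Fin m) (Fin m) ℝ) : (oneBlock Y).det = Y.det := by
  rw [det_succ_row_zero, Fin.sum_univ_succ]
  have h : (oneBlock Y).submatrix Fin.succ Fin.succ = Y := rfl
  simp only [Fin.succAbove_zero, h]
  simp [oneBlock]

lemma oneBlock_mem_specialOrthogonalGroup_iff {Y : Matrix (Fin m) (Fin m) ℝ} :
    oneBlock Y ∈ specialOrthogonalGroup (Fin (m + 1)) ℝ
      ↔ Y ∈ specialOrthogonalGroup (Fin m) ℝ := by
  rw [mem_specialOrthogonalGroup_iff, mem_specialOrthogonalGroup_iff, mem_orthogonalGroup_iff,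
    mem_orthogonalGroup_iff, oneBlock_transpose, oneBlock_mul_oneBlock, det_oneBlock,
    ← oneBlock_one, (Function.LeftInverse.injective minorMap_oneBlock).eq_iff]

/-- Row 0 is a unit vector, and its first entry already exhausts the norm. -/
lemma row_zero_of_orthogonal {h : Matrix (Fin (m + 1)) (Fin (m + 1)) ℝ}
    (hh : h ∈ orthogonalGroup (Fin (m + 1)) ℝ) (h00 : h 0 0 = 1) (j : Fin m) : h 0 j.succ = 0 := by
  have h1 := congrFun (congrFun (mul_transpose_of_orthogonal hh) 0) 0
  simp only [mul_apply, transpose_apply, Fin.sum_univ_succ, h00, one_apply_eq, mul_one,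
    add_eq_left] at h1
  exact mul_self_eq_zero.1 ((Finset.sum_eq_zero_iff_of_nonneg fun i _ =>
    mul_self_nonneg (h 0 i.succ)).1 h1 j (Finset.mem_univ j))

lemma oneBlock_minorMap {h : Matrix (Fin (m + 1)) (Fin (m + 1)) ℝ} (h00 : h 0 0 = 1)
    (hrow : ∀ j : Fin m, h 0 j.succ = 0) (hcol : ∀ i : Fin m, h i.succ 0 = 0) :
    oneBlock (minorMap m h) = h := by
  ext i j
  cases i using Fin.cases <;> cases j using Fin.cases
  · exact h00.symm
  · exact (hrow _).symm
  · exact (hcol _).symm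
  · rfl

lemma oneBlock_minorMap_of_orthogonal {h : Matrix (Fin (m + 1)) (Fin (m + 1)) ℝ}
    (hh : h ∈ orthogonalGroup (Fin (m + 1)) ℝ) (h00 : h 0 0 = 1) :
    oneBlock (minorMap m h) = h :=
  oneBlock_minorMap h00 (row_zero_of_orthogonal hh h00) fun i =>
    row_zero_of_orthogonal (transpose_mem_orthogonalGroup hh) h00 i

lemma rankOne_slice_affinelyIsomorphic {C : Matrix (Fin (m + 1)) (Fin (m + 1)) ℝ}
    (hC : C ∈ rankOneNormals (m + 1)) :
    AffinelyIsomorphic (orbitopeSlice C 1) (tautologicalOrbitopeSO m) := by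
  have hbound : ∀ g ∈ specialOrthogonalGroup (Fin (m + 1)) ℝ, frobeniusPairing C g ≤ 1 :=
    fun g hg => frobeniusPairing_rankOne_le_of_mem hC (mem_tautologicalOrbitopeSO hg)
  obtain ⟨A, hA, B, hB, rfl⟩ := hC
  have hA' := (mem_specialOrthogonalGroup_iff.1 hA).1
  have hB' := (mem_specialOrthogonalGroup_iff.1 hB).1
  let L : Matrix (Fin (m + 1)) (Fin (m + 1)) ℝ →ₗ[ℝ] Matrix (Fin (m + 1)) (Fin (m + 1)) ℝ :=
    LinearMap.mulRight ℝ B ∘ₗ LinearMap.mulLeft ℝ Aᵀ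
  have hL (X) : L X = Aᵀ * X * B := rfl
  have hLinv (X) : A * L X * Bᵀ = X := by
    calc A * (Aᵀ * X * B) * Bᵀ = (A * Aᵀ) * X * (B * Bᵀ) := by simp only [Matrix.mul_assoc]
      _ = X := by
        rw [mul_transpose_of_orthogonal hA', mul_transpose_of_orthogonal hB', Matrix.one_mul,
          Matrix.mul_one]
  have hLinv' (Z) : L (A * Z * Bᵀ) = Z := by
    calc Aᵀ * (A * Z * Bᵀ) * B = (Aᵀ * A) * Z * (Bᵀ * B) := by simp only [Matrix.mul_assoc]
      _ = Z := by
        rw [transpose_mul_of_orthogonal hA', transpose_mul_of_orthogonal hB', Matrix.one_mul,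
          Matrix.mul_one]
  have hpair (X) : frobeniusPairing (A * single 0 0 1 * Bᵀ) X = L X 0 0 := by
    rw [frobeniusPairing_mul_mul, frobeniusPairing_single, hL]
  have hLmem : ∀ g ∈ specialOrthogonalGroup (Fin (m + 1)) ℝ,
      L g ∈ specialOrthogonalGroup (Fin (m + 1)) ℝ := fun g hg =>
    mul_mem (mul_mem (transpose_mem_specialOrthogonalGroup hA) hg) hB
  have hslice : orbitopeSlice (A * single 0 0 1 * Bᵀ) 1 = convexHull ℝ
      {g | g ∈ specialOrthogonalGroup (Fin (m + 1)) ℝ ∧ L g 0 0 = 1} := by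
    simp only [← hpair]
    exact convexHull_inter_level_eq _ hbound
  refine ⟨(minorMap m ∘ₗ L).toAffineMap, ?_, ?_⟩
  -- `minorMap` is not injective on all matrices. The shape `1 ⊕ Y` is an affine condition, so it
  -- passes from the rotations to the affine hull, where `oneBlock` inverts the map.
  · have hinv : ∀ X ∈ affineSpan ℝ (orbitopeSlice (A * single 0 0 1 * Bᵀ) 1),
        L X 0 0 = 1 ∧ (∀ j : Fin m, L X 0 j.succ = 0) ∧ ∀ i : Fin m, L X i.succ 0 = 0 := by
      intro X hX
      rw [hslice, affineSpan_convexHull] at hX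
      refine affineSpan_induction hX (fun g hg => ?_) fun c u v w hu hv hw => ?_
      · have ho := (mem_specialOrthogonalGroup_iff.1 (hLmem g hg.1)).1
        exact ⟨hg.2, row_zero_of_orthogonal ho hg.2, fun i =>
          row_zero_of_orthogonal (transpose_mem_orthogonalGroup ho) hg.2 i⟩
      · simp [hu, hv, hw]
    have hleft : ∀ X ∈ affineSpan ℝ (orbitopeSlice (A * single 0 0 1 * Bᵀ) 1),
        A * oneBlock (minorMap m (L X)) * Bᵀ = X := fun X hX => by
      obtain ⟨h1, h2, h3⟩ := hinv X hX
      rw [oneBlock_minorMap h1 h2 h3, hLinv]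
    exact Set.LeftInvOn.injOn (f₁' := fun Y => A * oneBlock Y * Bᵀ) hleft
  · rw [hslice, AffineMap.image_convexHull, tautologicalOrbitopeSO]
    congr 1
    ext Y
    constructor
    · rintro ⟨g, ⟨hg, hg0⟩, rfl⟩
      have hLg := hLmem g hg
      rw [← oneBlock_minorMap_of_orthogonal (mem_specialOrthogonalGroup_iff.1 hLg).1 hg0] at hLg
      exact oneBlock_mem_specialOrthogonalGroup_iff.1 hLg
    · intro hY
      refine ⟨A * oneBlock Y * Bᵀ, ⟨mul_mem (mul_mem hA
        (oneBlock_mem_specialOrthogonalGroup_iff.2 hY))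
        (transpose_mem_specialOrthogonalGroup hB), ?_⟩, ?_⟩
      · rw [hLinv']
        rfl
      · change minorMap m (L _) = Y
        rw [hLinv', minorMap_oneBlock]

end StabilizerFacet

theorem mainTheorem3 (n : ℕ) (hn : 4 ≤ n) :
    ∃ O₁ O₂ : Set (Set (Matrix (Fin n) (Fin n) ℝ)),
      O₁ ≠ O₂ ∧
      facetOrbitsSO n = {O₁, O₂} ∧
      (∀ S ∈ O₁, AffinelyIsomorphic S (tautologicalOrbitopeSO (n - 1))) ∧
      (∀ S ∈ O₂, AffinelyIsomorphic S (freeSpectrahedron n) ∧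
        convexDim S = (n + 1).choose 2 - 1) := by
  -- Writing `n = m + 1` makes `n - 1` reduce to `m` and supplies the index 0.
  obtain ⟨m, rfl⟩ : ∃ m, n = m + 1 := ⟨n - 1, by omega⟩
  have hC : single 0 0 1 ∈ rankOneNormals (m + 1) :=
    ⟨1, one_mem _, 1, one_mem _, by simp⟩
  have hw := single_dotProduct_single (0 : Fin (m + 1))
  have hR : householder (Pi.single 0 1) ∈ improperNormals (m + 1) :=
    ⟨householder_mem_orthogonalGroup hw, det_householder hw⟩
  refine ⟨{T | ∃ C ∈ rankOneNormals (m + 1), T = orbitopeSlice C 1},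
    {T | ∃ R ∈ improperNormals (m + 1), T = orbitopeSlice R ((m + 1 : ℕ) - 2)}, ?_, ?_, ?_, ?_⟩
  · intro h
    obtain ⟨R, hR, hCR⟩ := h.subset ⟨_, hC, rfl⟩
    exact not_rankOne_slice_subset_improper hn hC hR hCR.subset
  · ext O
    simp only [facetOrbitsSO, isConvexFacet_tautologicalOrbitopeSO_iff hn, Set.mem_ofPred_eq,
      Set.mem_insert_iff, Set.mem_singleton_iff]
    constructor
    · rintro ⟨S, ⟨C, hC, rfl⟩ | ⟨R, hR, rfl⟩, rfl⟩
      · exact Or.inl (rotationOrbit_rankOne_slice hC)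
      · exact Or.inr (rotationOrbit_improper_slice hR _)
    · rintro (rfl | rfl)
      · exact ⟨_, Or.inl ⟨_, hC, rfl⟩, (rotationOrbit_rankOne_slice hC).symm⟩
      · exact ⟨_, Or.inr ⟨_, hR, rfl⟩, (rotationOrbit_improper_slice hR _).symm⟩
  · rintro _ ⟨C, hC, rfl⟩
    exact rankOne_slice_affinelyIsomorphic hC
  · rintro _ ⟨R, hR, rfl⟩
    exact ⟨improper_slice_affinelyIsomorphic hR, convexDim_improper_slice hR⟩
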